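/- **Setting.** Let $p\ge 2$. Undirected edge sets on $\{1,\dots,p\}$ are sets $\mathcal E$ of unordered pairs of distinct nodes; for $e=\{i,j\}$ with $i<j$ let $\mathbf g_e\in\mathbb R^p$ have entry $1$ at $i$, $-1$ at $j$ and $0$ elsewhere, and let $$\mathcal L_p(\mathcal E)=\Big\{\mathbf L=\sum_{e\in\mathcal E}w_e\,\mathbf g_e\mathbf g_e^\top:\ w_e\ge 0,\ \lambda_2(\mathbf L)>0\Big\}$$ be the set of Laplacians of connected weighted graphs with edge set contained in $\mathcal E$ ($\lambda_2$ is the second smallest eigenvalue). Let $\mathbf L^\star$ be such a Laplacian (for the complete edge set), and let $\mathcal E^\star$ be the set of its edges with positive weight. Write $\mathbf A^\dagger$ for the Moore–Penrose pseudo-inverse and $\det^\dagger\mathbf A$ for the product of the nonzero eigenvalues. Let $\mathbf x^{(1)},\dots,\mathbf x^{(n)}$ be i.i.d. zero-mean random vectors in $\mathbb R^p$ with covariance matrix $(\mathbf L^\star)^\dagger$, distributed as a vector $\mathbf x$ that is sub-Gaussian with constants $c_0,c_1>0$: for all $\mathbf u\in\mathbb R^p$ and all real $r\ge1$, $$\big(\mathbb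 E|\mathbf u^\top\mathbf x|^r\big)^{1/r}\le c_0\,\|\mathbf u^\top\mathbf x\|_{\Psi_2}\sqrt r,\qquad \|\mathbf u^\top\mathbf x\|_{\Psi_2}^2\le \mathbb E[(\mathbf u^\top\mathbf x)^2]/c_1,$$ where $\|Y\|_{\Psi_2}=\inf\{K>0:\mathbb E\,e^{Y^2/K^2}\le2\}$. Let $\mathbf S=\frac1n\sum_k\mathbf x^{(k)}\mathbf x^{(k)\top}$, and let $$\mathcal E_\exists=\Big\{\{i,j\}:\ \tfrac1n\sum_{k}(x_i^{(k)}-x_j^{(k)})^2>0\Big\}.$$ For an edge set $\mathcal E$ the estimator is $$\widehat{\mathbf L}\in\operatorname*{arg\,min}_{\mathbf L\in\mathcal L_p(\mathcal E)}\ -\log{\det}^\dagger(\mathbf L)+\operatorname{tr}(\mathbf L\mathbf S),$$ and the symmetrized Stein loss is $L^{ss}(\mathbf L_1,\mathbf L_2)=\frac12\big(\ell^s(\mathbf L_1,\mathbf L_2)+\ell^s(\mathbf L_2,\mathbf L_1)\big)$ with $$\ell^s(\mathbf L_1,\mathbf L_2)=\frac{\operatorname{tr}(\mathbf L_1\mathbf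 L_2^\dagger)-\log\det^\dagger\mathbf L_1+\log\det^\dagger\mathbf L_2}{p-1}-1.$$ **Theorem 2.** For all $c_0,c_1>0$ there are constants $c',C'>0$ depending only on $c_0,c_1$ (in particular not on $p$, $n$, $\mathbf L^\star$, the graph structure or its sparsity) such that, in the above setting, if $n\ge c'\log p$, then with probability at least $1-2/p^2$ the data satisfy the following: $\mathcal E^\star\subset\mathcal E_\exists$, and for every edge set $\mathcal E$ with $\mathcal E^\star\subset\mathcal E\subset\mathcal E_\exists$ the estimator $\widehat{\mathbf L}$ exists, and every such estimator satisfies $$L^{ss}(\widehat{\mathbf L},\mathbf L^\star)\le C'\sqrt{\frac{\log p}{n}}.$$ -/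

import Mathlib

open MeasureTheory ProbabilityTheory
open scoped ENNReal Matrix

noncomputable section

namespace CGL

/-! ### Pseudo-inverse and pseudo-determinant -/

/-- `B` satisfies the four Penrose equations for the real square matrix `A`. -/
structure IsMoorePenrose {p : ℕ} (A B : Matrix (Fin p) (Fin p) ℝ) : Prop where
  mul_mul_self : A * B * A = A
  mul_mul_inv : B * A * B = B
  symm_left : (A * B)ᵀ = A * B
  symm_right : (B * A)ᵀ = B * A

theorem IsMoorePenrose.unique {p : ℕ} {A B C : Matrix (Fin p) (Fin p) ℝ}
    (hB : IsMoorePenrose A B) (hC : IsMoorePenrose A C) : B = C := by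
  have h1 : A * B = A * C := by
    calc A * B = (A * B)ᵀ := hB.symm_left.symm
      _ = ((A * C) * (A * B))ᵀ := by rw [← Matrix.mul_assoc, hC.mul_mul_self]
      _ = (A * B) * (A * C) := by rw [Matrix.transpose_mul, hB.symm_left, hC.symm_left]
      _ = A * C := by rw [← Matrix.mul_assoc, hB.mul_mul_self]
  have h2 : B * A = C * A := by
    calc B * A = (B * A)ᵀ := hB.symm_right.symm
      _ = ((B * A) * (C * A))ᵀ := by
          rw [Matrix.mul_assoc B A, ← Matrix.mul_assoc A C A, hC.mul_mul_self]
      _ = (C * A) * (B * A) := by rw [Matrix.transpose_mul, hB.symm_right, hC.symm_right]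
      _ = C * A := by rw [Matrix.mul_assoc C A, ← Matrix.mul_assoc A B A, hB.mul_mul_self]
  calc B = B * A * B := hB.mul_mul_inv.symm
    _ = C * A * C := by rw [h2, Matrix.mul_assoc, h1, ← Matrix.mul_assoc]
    _ = C := hC.mul_mul_inv

theorem exists_isMoorePenrose {p : ℕ} {A : Matrix (Fin p) (Fin p) ℝ} (hA : A.IsHermitian) :
    ∃ B, IsMoorePenrose A B := by
  set φ := Unitary.conjStarAlgAut ℝ (Matrix (Fin p) (Fin p) ℝ) hA.eigenvectorUnitary with hφ
  obtain ⟨d, hAφ⟩ : ∃ d : Fin p → ℝ, A = φ (Matrix.diagonal d) :=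
    ⟨hA.eigenvalues, hA.spectral_theorem⟩
  have htr : ∀ d : Fin p → ℝ, (φ (Matrix.diagonal d))ᵀ = φ (Matrix.diagonal d) := by
    intro d
    have h := map_star φ (Matrix.diagonal d)
    rw [Matrix.star_eq_conjTranspose, Matrix.star_eq_conjTranspose,
      Matrix.diagonal_conjTranspose, star_trivial, Matrix.conjTranspose_eq_transpose_of_trivial] at h
    exact h.symm
  have h1 : (fun i => d i * (d i)⁻¹ * d i) = d := by
    ext i; exact mul_inv_mul_cancel (d i)
  have h2 : (fun i => (d i)⁻¹ * d i * (d i)⁻¹) = fun i => (d i)⁻¹ := by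
    ext i; by_cases h : d i = 0 <;> simp [h]
  refine ⟨φ (Matrix.diagonal fun i => (d i)⁻¹), ?_, ?_, ?_, ?_⟩
  · rw [hAφ, ← map_mul, ← map_mul, Matrix.diagonal_mul_diagonal, Matrix.diagonal_mul_diagonal, h1]
  · rw [hAφ, ← map_mul, ← map_mul, Matrix.diagonal_mul_diagonal, Matrix.diagonal_mul_diagonal, h2]
  · rw [hAφ, ← map_mul, Matrix.diagonal_mul_diagonal]; exact htr _
  · rw [hAφ, ← map_mul, Matrix.diagonal_mul_diagonal]; exact htr _

open Classical in
/-- The Moore-Penrose pseudo-inverse `A†` of a real symmetric matrix. -/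
def pinv {p : ℕ} (A : Matrix (Fin p) (Fin p) ℝ) : Matrix (Fin p) (Fin p) ℝ :=
  if h : ∃ B, IsMoorePenrose A B then h.choose else 0

theorem isMoorePenrose_pinv {p : ℕ} {A : Matrix (Fin p) (Fin p) ℝ} (hA : A.IsHermitian) :
    IsMoorePenrose A (pinv A) := by
  have h := exists_isMoorePenrose hA
  rw [pinv, dif_pos h]
  exact h.choose_spec

/-- The pseudo-determinant `det† A`: the product of the nonzero eigenvalues, with multiplicity,
of a real symmetric matrix (all roots of its characteristic polynomial are real). -/
def pdet {p : ℕ} (A : Matrix (Fin p) (Fin p) ℝ) : ℝ :=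
  (A.charpoly.roots.filter (· ≠ 0)).prod

/-! ### Combinatorial graph Laplacians -/

/-- The edge vector `g_e` of `e = (i, j)`: `1` at `i`, `-1` at `j`, `0` elsewhere. -/
def edgeVec {p : ℕ} (e : Fin p × Fin p) : Fin p → ℝ :=
  Pi.single e.1 1 - Pi.single e.2 1

open Classical in
/-- The edges of `E`, each undirected edge being listed once, as `(i, j)` with `i < j`. -/
def edges {p : ℕ} (E : SimpleGraph (Fin p)) : Finset (Fin p × Fin p) :=
  Finset.univ.filter fun e => e.1 < e.2 ∧ E.Adj e.1 e.2

/-- The Laplacian `∑_{e ∈ E} w_e g_e g_eᵀ` of the edge set `E` with edge weights `w`. -/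
def laplacian {p : ℕ} (E : SimpleGraph (Fin p)) (w : Fin p × Fin p → ℝ) :
    Matrix (Fin p) (Fin p) ℝ :=
  ∑ e ∈ edges E, w e • Matrix.vecMulVec (edgeVec e) (edgeVec e)

/-- `λ₂(L) > 0`: the second smallest eigenvalue, with multiplicity, of the symmetric `p × p`
matrix `L` is positive. (`eigenvalues₀` lists the eigenvalues in decreasing order.) -/
def LambdaTwoPos {p : ℕ} (L : Matrix (Fin p) (Fin p) ℝ) : Prop :=
  ∃ hL : L.IsHermitian, ∀ hp : 2 ≤ p,
    0 < hL.eigenvalues₀ ⟨p - 2, by rw [Fintype.card_fin]; omega⟩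

/-- `𝓛_p(E)`: the Laplacians of connected graphs with edge set contained in `E`. -/
def laplacians {p : ℕ} (E : SimpleGraph (Fin p)) : Set (Matrix (Fin p) (Fin p) ℝ) :=
  {L | ∃ w : Fin p × Fin p → ℝ, (∀ e ∈ edges E, 0 ≤ w e) ∧ L = laplacian E w ∧ LambdaTwoPos L}

/-- The edge set of the weighted graph with Laplacian `L`: the pairs `i ≠ j` of nonzero
weight `w_ij = - L_ij`. -/
def edgeSetOf {p : ℕ} (L : Matrix (Fin p) (Fin p) ℝ) : SimpleGraph (Fin p) :=
  SimpleGraph.fromRel fun i j => L i j ≠ 0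

/-! ### Data, estimator, loss -/

/-- The sample covariance matrix `S = n⁻¹ ∑ₖ xₖ xₖᵀ` (the mean is known to be zero). -/
def sampleCov {p n : ℕ} (x : Fin n → Fin p → ℝ) : Matrix (Fin p) (Fin p) ℝ :=
  (n : ℝ)⁻¹ • ∑ k, Matrix.vecMulVec (x k) (x k)

/-- `h_ij = n⁻¹ ∑ₖ (x_i⁽ᵏ⁾ - x_j⁽ᵏ⁾)²`. -/
def sampleDist {p n : ℕ} (x : Fin n → Fin p → ℝ) (i j : Fin p) : ℝ :=
  (n : ℝ)⁻¹ * ∑ k, (x k i - x k j) ^ 2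

/-- The graph `E_∃` of the pairs with `h_ij > 0`. -/
def existGraph {p n : ℕ} (x : Fin n → Fin p → ℝ) : SimpleGraph (Fin p) where
  Adj i j := 0 < sampleDist x i j
  symm := ⟨fun i j h => by
    have e : sampleDist x j i = sampleDist x i j := by
      simp only [sampleDist, sub_sq_comm]
    rw [e]; exact h⟩
  loopless := ⟨fun i h => by simp [sampleDist] at h⟩

/-- The objective `-log det† L + tr (L S)`. -/
def objective {p : ℕ} (S L : Matrix (Fin p) (Fin p) ℝ) : ℝ :=
  -Real.log (pdet L) + (L * S).trace

/-- `L` is a combinatorial graph Laplacian estimate: a minimizer of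
`-log det† L + tr (L S)` over `𝓛_p(E)`. -/
def IsCGLE {p : ℕ} (E : SimpleGraph (Fin p)) (S L : Matrix (Fin p) (Fin p) ℝ) : Prop :=
  L ∈ laplacians E ∧ ∀ L' ∈ laplacians E, objective S L ≤ objective S L'

/-- Stein's loss `ℓˢ(L₁, L₂)` of Laplacians of connected graphs. -/
def steinLoss {p : ℕ} (L₁ L₂ : Matrix (Fin p) (Fin p) ℝ) : ℝ :=
  ((L₁ * pinv L₂).trace - Real.log (pdet L₁) + Real.log (pdet L₂)) / ((p : ℝ) - 1) - 1

/-- The symmetrized Stein loss `Lˢˢ(L₁, L₂)`. -/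
def symSteinLoss {p : ℕ} (L₁ L₂ : Matrix (Fin p) (Fin p) ℝ) : ℝ :=
  (steinLoss L₁ L₂ + steinLoss L₂ L₁) / 2

/-! ### The distributional assumption -/

/-- The sub-Gaussian norm `inf {K > 0 : E exp(Y² / K²) ≤ 2}` of a real random variable `Y`
(infinite if there is no such `K`). -/
def psiTwoNorm {α : Type*} [MeasurableSpace α] (P : Measure α) (Y : α → ℝ) : ℝ≥0∞ :=
  sInf {t | ∃ K : ℝ, 0 < K ∧ ∫⁻ a, ENNReal.ofReal (Real.exp (Y a ^ 2 / K ^ 2)) ∂P ≤ 2 ∧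
    t = ENNReal.ofReal K}

/-- The law `P` on `ℝᵖ` has zero mean and covariance matrix `Sig`, and it is sub-Gaussian with
constants `c₀`, `c₁`. -/
structure IsSubGaussianLaw {p : ℕ} (P : Measure (Fin p → ℝ)) (Sig : Matrix (Fin p) (Fin p) ℝ)
    (c₀ c₁ : ℝ) : Prop where
  /-- second moments are finite -/
  memLp : ∀ i, MemLp (fun x : Fin p → ℝ => x i) 2 P
  /-- zero mean -/
  mean : ∀ i, ∫ x, x i ∂P = 0
  /-- covariance matrix -/
  covariance : ∀ i j, cov[fun x : Fin p → ℝ => x i, fun x => x j; P] = Sig i j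
  /-- `(E |uᵀx|^r)^(1/r) ≤ c₀ ‖uᵀx‖_ψ₂ √r` -/
  moments : ∀ (u : Fin p → ℝ) (r : ℝ), 1 ≤ r →
    (∫⁻ x, ENNReal.ofReal (|u ⬝ᵥ x| ^ r) ∂P) ^ (1 / r) ≤
      ENNReal.ofReal c₀ * psiTwoNorm P (fun x => u ⬝ᵥ x) * ENNReal.ofReal (√r)
  /-- `‖uᵀx‖_ψ₂² ≤ E (uᵀx)² / c₁` -/
  psiTwo_sq_le : ∀ u : Fin p → ℝ,
    psiTwoNorm P (fun x => u ⬝ᵥ x) ^ 2 ≤ ENNReal.ofReal ((∫ x, (u ⬝ᵥ x) ^ 2 ∂P) / c₁)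

/-- `X 0, …, X (n-1)` are i.i.d. with zero mean, covariance matrix `L†`, and common law
sub-Gaussian with constants `c₀`, `c₁`. -/
structure IsSubGaussianSample {p n : ℕ} {Ω : Type*} [MeasurableSpace Ω] (μ : Measure Ω)
    (X : Fin n → Ω → Fin p → ℝ) (L : Matrix (Fin p) (Fin p) ℝ) (c₀ c₁ : ℝ) : Prop where
  indep : iIndepFun X μ
  law : ∃ P : Measure (Fin p → ℝ), IsSubGaussianLaw P (pinv L) c₀ c₁ ∧ ∀ k, HasLaw (X k) P μ

end CGL

end

/-! Write J for `avg p`, the projection onto constants. For a connected Laplacian L, adding J turns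
the pseudo-quantities into ordinary ones: `pdet L` is det(L + J) and `pinv L` is (L + J)⁻¹ - J.
Moreover tr(L S) is the weighted sum of the quadratic forms of S at edge vectors. If every empirical
distance h_e is within relative error δ of the effective resistance r_e = g_eᵀ L⋆† g_e, then tr(L S)
and tr(L L⋆†) agree up to the factor 1 ± δ for all Laplacians at once, whatever the sparsity.

The logarithms cancel in the symmetrized loss, which leaves tr(L̂ L⋆†) + tr(L⋆ L̂†). Optimality of
L̂ in the direction -L̂ gives tr(L̂ S) ≤ p - 1, and in the direction L⋆ it gives tr(L⋆ L̂†) ≤ tr(L⋆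
S). Replacing S by L⋆† costs factors 1 ± δ, and tr(L⋆ L⋆†) = p - 1, so dividing by p - 1 leaves a
loss of order δ (`IsCGLE.symSteinLoss_le`).

Each h_e / r_e is a mean of n i.i.d. nonnegative variables of mean one with a uniform exponential
moment. A Chernoff bound and a union over pairs allow δ of order √(log p / n)
(`IsSubGaussianSample.measureReal_biUnion_sampleDist_le`). On the same event all h_e are positive,
which makes the objective coercive, so the estimator exists (`exists_isCGLE`). -/

noncomputable section

namespace CGL

/-! ### The averaging projection -/

/-- The orthogonal projection `J = p⁻¹ 1 1ᵀ` onto the constant vectors. -/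
def avg (p : ℕ) : Matrix (Fin p) (Fin p) ℝ := Matrix.of fun _ _ => (p : ℝ)⁻¹

theorem avg_apply {p : ℕ} (i j : Fin p) : avg p i j = (p : ℝ)⁻¹ := rfl

theorem avg_eq_vecMulVec (p : ℕ) :
    avg p = Matrix.vecMulVec (fun _ => (p : ℝ)⁻¹) (fun _ => 1) := by
  ext i j; simp [avg_apply, Matrix.vecMulVec_apply]

theorem avg_mul_avg {p : ℕ} (hp : p ≠ 0) : avg p * avg p = avg p := by
  ext i j
  have : (p : ℝ) ≠ 0 := by exact_mod_cast hp
  simp [Matrix.mul_apply, avg_apply, mul_inv_cancel_left₀ this]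

theorem mul_avg_eq_zero {p : ℕ} {L : Matrix (Fin p) (Fin p) ℝ} (h : L *ᵥ 1 = 0) :
    L * avg p = 0 := by
  ext i j
  have := congrFun h i
  simp only [Matrix.mulVec, dotProduct, Pi.one_apply, mul_one, Pi.zero_apply] at this
  simp [Matrix.mul_apply, avg_apply, ← Finset.sum_mul, this]

theorem avg_transpose (p : ℕ) : (avg p)ᵀ = avg p := rfl

theorem avg_mul_eq_zero {p : ℕ} {L : Matrix (Fin p) (Fin p) ℝ} (hL : L.IsHermitian)
    (h : L *ᵥ 1 = 0) : avg p * L = 0 := by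
  have h1 := congrArg Matrix.transpose (mul_avg_eq_zero h)
  rw [Matrix.transpose_mul, avg_transpose, Matrix.transpose_zero] at h1
  have h2 : Lᵀ = L := by
    rw [← Matrix.conjTranspose_eq_transpose_of_trivial]; exact hL
  rwa [h2] at h1

theorem avg_posSemidef (p : ℕ) : (avg p).PosSemidef := by
  have h : avg p = (p : ℝ)⁻¹ • Matrix.vecMulVec (1 : Fin p → ℝ) (star 1) := by
    ext i j; simp [avg_apply]
  rw [h]
  exact (Matrix.posSemidef_vecMulVec_self_star _).smul (by positivity)

theorem trace_avg {p : ℕ} (hp : p ≠ 0) : (avg p).trace = 1 := by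
  have : (p : ℝ) ≠ 0 := by exact_mod_cast hp
  simp [Matrix.trace, avg_apply, this]

/-! ### Positive second eigenvalue, pseudo-determinant and pseudo-inverse -/

section

variable {p : ℕ} {L : Matrix (Fin p) (Fin p) ℝ}

theorem rank_eq_card_eigenvalues₀ (hL : L.IsHermitian) :
    L.rank = Fintype.card {k // hL.eigenvalues₀ k ≠ 0} := by
  rw [hL.rank_eq_card_non_zero_eigs]
  refine Fintype.card_congr (Equiv.subtypeEquiv
    (Fintype.equivOfCardEq (Fintype.card_fin _)).symm fun i => ?_)
  rfl

/-- The zero-based index p - 2 in decreasing order is the second smallest eigenvalue. For a positive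
semidefinite matrix it is positive exactly when the p - 1 largest eigenvalues are nonzero. -/
theorem lambdaTwoPos_iff_rank (hp : 2 ≤ p) (hL : L.PosSemidef) :
    LambdaTwoPos L ↔ p - 1 ≤ L.rank := by
  have hnn : ∀ k, 0 ≤ hL.1.eigenvalues₀ k := by
    intro k
    have := hL.eigenvalues_nonneg (Fintype.equivOfCardEq (Fintype.card_fin _) k)
    simpa [Matrix.IsHermitian.eigenvalues] using this
  constructor
  · rintro ⟨h, hpos⟩
    have hpos := hpos hp
    rw [rank_eq_card_eigenvalues₀ h]
    have := Fintype.card_le_of_injective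
      (fun k : Fin (p - 1) => (⟨⟨k, by rw [Fintype.card_fin]; omega⟩,
        (lt_of_lt_of_le hpos (h.eigenvalues₀_antitone (by
          rw [Fin.le_def]; have := k.2; simp only; omega))).ne'⟩ :
        {k // h.eigenvalues₀ k ≠ 0}))
      (fun a b hab => by simpa [Fin.ext_iff] using hab)
    simpa using this
  · intro hr
    refine ⟨hL.1, fun _ => ?_⟩
    by_contra hneg
    push Not at hneg
    rw [rank_eq_card_eigenvalues₀ hL.1] at hr
    have := Fintype.card_le_of_injective
      (fun k : {k // hL.1.eigenvalues₀ k ≠ 0} => (⟨k.1, by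
        by_contra hk
        exact k.2 (le_antisymm ((hL.1.eigenvalues₀_antitone (by
          rw [Fin.le_def]; simp only; omega)).trans hneg) (hnn _))⟩ : Fin (p - 2)))
      (fun a b hab => by
        have : (a.1 : ℕ) = b.1 := by simpa [Fin.ext_iff] using hab
        exact Subtype.ext (Fin.ext this))
    have := hr.trans (this.trans_eq (Fintype.card_fin _))
    omega

/-- If the kernel of L is only the constants, a null vector of L + J is constant and has sum zero,
hence vanishes. Conversely J has rank at most one, so invertibility forces rank L ≥ p - 1. -/
theorem lambdaTwoPos_iff_det (hp : 2 ≤ p) (hL : L.PosSemidef) (h1 : L *ᵥ 1 = 0) :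
    LambdaTwoPos L ↔ (L + avg p).det ≠ 0 := by
  have hp0 : p ≠ 0 := by omega
  rw [lambdaTwoPos_iff_rank hp hL]
  constructor
  · intro hr hdet
    obtain ⟨v, hv, hMv⟩ := Matrix.exists_mulVec_eq_zero_iff.2 hdet
    have hJv : avg p *ᵥ v = 0 := by
      have := congrArg (fun x => avg p *ᵥ x) hMv
      simpa [Matrix.mulVec_mulVec, Matrix.mul_add, avg_mul_eq_zero hL.1 h1, avg_mul_avg hp0]
        using this
    have hLv : L *ᵥ v = 0 := by
      rw [Matrix.add_mulVec, hJv, add_zero] at hMv; exact hMv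
    have hker : Module.finrank ℝ (LinearMap.ker L.mulVecLin) ≤ 1 := by
      have := L.mulVecLin.finrank_range_add_finrank_ker
      rw [Module.finrank_fin_fun] at this
      have h2 : L.rank = Module.finrank ℝ (LinearMap.range L.mulVecLin) := rfl
      omega
    obtain ⟨z, hz⟩ := finrank_le_one_iff.1 hker
    obtain ⟨a, ha⟩ := hz ⟨1, by simpa using h1⟩
    obtain ⟨b, hb⟩ := hz ⟨v, by simpa using hLv⟩
    have ha' : a • (z : Fin p → ℝ) = 1 := congrArg Subtype.val ha
    have hb' : b • (z : Fin p → ℝ) = v := congrArg Subtype.val hb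
    have hsum : ∑ i, v i = 0 := by
      have := congrFun hJv ⟨0, by omega⟩
      simp only [Matrix.mulVec, dotProduct, avg_apply, ← Finset.mul_sum, Pi.zero_apply] at this
      exact (mul_eq_zero.1 this).resolve_left (inv_ne_zero (by exact_mod_cast hp0))
    have hza : ∀ i, a * (z : Fin p → ℝ) i = 1 := fun i => congrFun ha' i
    have hav : ∀ i, a * v i = b := fun i => by
      rw [← hb', Pi.smul_apply, smul_eq_mul]; linear_combination b * hza i
    have hb0 : b = 0 := by
      have h3 : ∑ i, a * v i = p * b := by simp [hav]
      rw [← Finset.mul_sum, hsum, mul_zero] at h3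
      exact (mul_eq_zero.1 h3.symm).resolve_left (by exact_mod_cast hp0)
    apply hv
    rw [← hb', hb0, zero_smul]
  · intro hdet
    have h2 : (L + avg p).rank = p := by
      rw [Matrix.rank_of_isUnit _ ((Matrix.isUnit_iff_isUnit_det _).2 (isUnit_iff_ne_zero.2 hdet)),
        Fintype.card_fin]
    have h3 : (L + avg p).rank ≤ L.rank + (avg p).rank := by
      unfold Matrix.rank
      rw [Matrix.mulVecLin_add]
      refine (Submodule.finrank_mono (LinearMap.range_add_le _ _)).trans
        (Submodule.finrank_add_le_finrank_add_finrank _ _)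
    have h4 : (avg p).rank ≤ 1 := by
      rw [avg_eq_vecMulVec]; exact Matrix.rank_vecMulVec_le _ _
    omega

theorem lambdaTwoPos_posDef (hp : 2 ≤ p) (hL : L.PosSemidef) (h1 : L *ᵥ 1 = 0)
    (h : LambdaTwoPos L) : (L + avg p).PosDef := by
  rw [(hL.add (avg_posSemidef p)).posDef_iff_isUnit, Matrix.isUnit_iff_isUnit_det]
  exact isUnit_iff_ne_zero.2 ((lambdaTwoPos_iff_det hp hL h1).1 h)

theorem charpoly_avg (hp : 2 ≤ p) :
    (avg p).charpoly = Polynomial.X ^ (p - 1) * (Polynomial.X - Polynomial.C 1) := by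
  rw [avg_eq_vecMulVec, Matrix.charpoly_vecMulVec]
  have : (p : ℝ) ≠ 0 := by norm_cast; omega
  obtain ⟨q, rfl⟩ : ∃ q, p = q + 1 := ⟨p - 1, by omega⟩
  simp [dotProduct, this, -Nat.cast_add]
  ring

/-- Since L J = 0, the product (X - L)(X - J) collapses to X (X - (L + J)); take determinants. -/
theorem charpoly_mul_charpoly_avg (h1 : L *ᵥ 1 = 0) :
    L.charpoly * (avg p).charpoly = Polynomial.X ^ p * (L + avg p).charpoly := by
  simp only [Matrix.charpoly]
  rw [← Matrix.det_mul]
  have h : L.charmatrix * (avg p).charmatrix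
      = (Polynomial.X : Polynomial ℝ) • (L + avg p).charmatrix := by
    simp only [Matrix.charmatrix]
    have h0 : (Polynomial.C : ℝ →+* _).mapMatrix L * Polynomial.C.mapMatrix (avg p) = 0 := by
      rw [← map_mul, mul_avg_eq_zero h1, map_zero]
    rw [sub_mul, mul_sub, mul_sub, h0, map_add, smul_sub, smul_add]
    simp only [Matrix.scalar_apply, ← Matrix.smul_one_eq_diagonal, smul_mul_assoc, mul_smul_comm,
      one_mul, mul_one]
    abel
  rw [h, Matrix.det_smul, Fintype.card_fin]

/-- Compare the roots in `charpoly_mul_charpoly_avg` after discarding zeros: J contributes only the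
root 1, and no root of L + J is lost because it is invertible. -/
theorem pdet_eq_det (hp : 2 ≤ p) (hL : L.PosSemidef) (h1 : L *ᵥ 1 = 0) (h : LambdaTwoPos L) :
    pdet L = (L + avg p).det := by
  have hH : (L + avg p).IsHermitian := (hL.add (avg_posSemidef p)).1
  have hdet := (lambdaTwoPos_iff_det hp hL h1).1 h
  have hX : (Polynomial.X : Polynomial ℝ) ≠ 0 := Polynomial.X_ne_zero
  have e := congrArg Polynomial.roots (charpoly_mul_charpoly_avg h1)
  rw [Polynomial.roots_mul (mul_ne_zero (Matrix.charpoly_monic _).ne_zero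
      (Matrix.charpoly_monic _).ne_zero),
    Polynomial.roots_mul (mul_ne_zero (pow_ne_zero _ hX) (Matrix.charpoly_monic _).ne_zero),
    charpoly_avg hp, Polynomial.roots_mul (mul_ne_zero (pow_ne_zero _ hX)
      (Polynomial.X_sub_C_ne_zero _)), Polynomial.roots_pow, Polynomial.roots_pow,
    Polynomial.roots_X, Polynomial.roots_X_sub_C] at e
  have e2 := congrArg (fun s => (Multiset.filter (· ≠ 0) s).prod) e
  simp only [Multiset.filter_add, Multiset.prod_add, Multiset.nsmul_singleton] at e2
  have hz : ∀ m : ℕ, Multiset.filter (· ≠ (0 : ℝ)) (Multiset.replicate m 0) = 0 := fun m =>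
    Multiset.filter_eq_nil.2 fun a ha => by simp [Multiset.eq_of_mem_replicate ha]
  have hall : Multiset.filter (· ≠ (0 : ℝ)) (L + avg p).charpoly.roots
      = (L + avg p).charpoly.roots := by
    rw [Multiset.filter_eq_self]
    rintro a ha rfl
    apply hdet
    rw [Matrix.det_eq_prod_roots_charpoly_of_splits hH.splits_charpoly]
    exact Multiset.prod_eq_zero ha
  rw [hz, hz, hall, ← Matrix.det_eq_prod_roots_charpoly_of_splits hH.splits_charpoly] at e2
  simpa [pdet, Multiset.filter_singleton] using e2

/-- L + J is the identity on constants and L on their orthogonal complement, so subtracting J from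
its inverse leaves the inverse of L there. Both products with L equal 1 - J, and uniqueness in the
Penrose equations concludes. -/
theorem pinv_eq (hp : 2 ≤ p) (hL : L.PosSemidef) (h1 : L *ᵥ 1 = 0) (h : LambdaTwoPos L) :
    pinv L = (L + avg p)⁻¹ - avg p := by
  have hp0 : p ≠ 0 := by omega
  have hdet : IsUnit (L + avg p).det :=
    isUnit_iff_ne_zero.2 ((lambdaTwoPos_iff_det hp hL h1).1 h)
  set J := avg p with hJ
  set M := L + J with hM
  have hLM : L = M - J := by rw [hM]; abel
  have hJJ : J * J = J := avg_mul_avg hp0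
  have hMJ : M * J = J := by rw [hM, add_mul, mul_avg_eq_zero h1, hJJ, zero_add]
  have hJM : J * M = J := by rw [hM, mul_add, avg_mul_eq_zero hL.1 h1, hJJ, zero_add]
  have hMi : M⁻¹ * M = 1 := Matrix.nonsing_inv_mul _ hdet
  have hiM : M * M⁻¹ = 1 := Matrix.mul_nonsing_inv _ hdet
  have hiJ : M⁻¹ * J = J := by
    calc M⁻¹ * J = M⁻¹ * (M * J) := by rw [hMJ]
      _ = J := by rw [← mul_assoc, hMi, one_mul]
  have hJi : J * M⁻¹ = J := by
    calc J * M⁻¹ = (J * M) * M⁻¹ := by rw [hJM]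
      _ = J := by rw [mul_assoc, hiM, mul_one]
  have hl : L * (M⁻¹ - J) = 1 - J := by
    rw [hLM, sub_mul, mul_sub, mul_sub, hiM, hMJ, hJi, hJJ]; abel
  have hr : (M⁻¹ - J) * L = 1 - J := by
    rw [hLM, sub_mul, mul_sub, mul_sub, hMi, hJM, hiJ, hJJ]; abel
  have hs : (1 - J)ᵀ = 1 - J := by rw [Matrix.transpose_sub, Matrix.transpose_one]; rfl
  refine (isMoorePenrose_pinv hL.1).unique ⟨?_, ?_, ?_, ?_⟩
  · rw [hl, sub_mul, one_mul, avg_mul_eq_zero hL.1 h1, sub_zero]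
  · rw [hr, sub_mul, one_mul, mul_sub, hJi, hJJ]; abel
  · rw [hl, hs]
  · rw [hr, hs]

theorem trace_mul_pinv_self (hp : 2 ≤ p) (hL : L.PosSemidef) (h1 : L *ᵥ 1 = 0)
    (h : LambdaTwoPos L) : (L * pinv L).trace = p - 1 := by
  have hdet : IsUnit (L + avg p).det :=
    isUnit_iff_ne_zero.2 ((lambdaTwoPos_iff_det hp hL h1).1 h)
  have e : L * pinv L = (L + avg p) * (L + avg p)⁻¹ - avg p * (L + avg p)⁻¹ := by
    rw [pinv_eq hp hL h1 h, mul_sub, mul_avg_eq_zero h1, sub_zero, ← sub_mul, add_sub_cancel_right]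
  have e2 : avg p * (L + avg p)⁻¹ = avg p := by
    calc avg p * (L + avg p)⁻¹ = (avg p * (L + avg p)) * (L + avg p)⁻¹ := by
          rw [mul_add, avg_mul_eq_zero hL.1 h1, avg_mul_avg (by omega), zero_add]
      _ = avg p := by rw [mul_assoc, Matrix.mul_nonsing_inv _ hdet, mul_one]
  rw [e, e2, Matrix.mul_nonsing_inv _ hdet, Matrix.trace_sub, Matrix.trace_one,
    trace_avg (by omega), Fintype.card_fin]

end

/-! ### Laplacians -/

section

variable {p : ℕ} {E : SimpleGraph (Fin p)} {w : Fin p × Fin p → ℝ}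

theorem mem_edges {e : Fin p × Fin p} : e ∈ edges E ↔ e.1 < e.2 ∧ E.Adj e.1 e.2 := by
  simp [edges]

theorem laplacian_congr {w' : Fin p × Fin p → ℝ} (h : ∀ e ∈ edges E, w e = w' e) :
    laplacian E w = laplacian E w' :=
  Finset.sum_congr rfl fun e he => by rw [h e he]

theorem laplacian_posSemidef (hw : ∀ e ∈ edges E, 0 ≤ w e) : (laplacian E w).PosSemidef :=
  Matrix.posSemidef_sum _ fun e he =>
    (by simpa using Matrix.posSemidef_vecMulVec_self_star (edgeVec e) :
      (Matrix.vecMulVec (edgeVec e) (edgeVec e)).PosSemidef).smul (hw e he)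

theorem edgeVec_dotProduct (e : Fin p × Fin p) (v : Fin p → ℝ) :
    edgeVec e ⬝ᵥ v = v e.1 - v e.2 := by
  simp [edgeVec, sub_dotProduct]

theorem laplacian_mulVec_one : laplacian E w *ᵥ 1 = 0 := by
  rw [laplacian, Matrix.sum_mulVec]
  refine Finset.sum_eq_zero fun e _ => ?_
  rw [Matrix.smul_mulVec, Matrix.vecMulVec_mulVec, edgeVec_dotProduct]
  simp

theorem trace_laplacian_mul (S : Matrix (Fin p) (Fin p) ℝ) :
    (laplacian E w * S).trace = ∑ e ∈ edges E, w e * (edgeVec e ⬝ᵥ S *ᵥ edgeVec e) := by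
  rw [laplacian, Finset.sum_mul, Matrix.trace_sum]
  refine Finset.sum_congr rfl fun e _ => ?_
  rw [smul_mul_assoc, Matrix.trace_smul, smul_eq_mul, Matrix.vecMulVec_mul,
    Matrix.trace_vecMulVec, dotProduct_comm, Matrix.dotProduct_mulVec]

theorem laplacian_apply_of_mem {i j : Fin p} (h : (i, j) ∈ edges E) :
    laplacian E w i j = -w (i, j) := by
  rw [laplacian, Matrix.sum_apply, Finset.sum_eq_single (i, j)]
  · have hij : i ≠ j := (mem_edges.1 h).1.ne
    simp [Matrix.vecMulVec_apply, edgeVec, hij, hij.symm]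
  · rintro ⟨a, b⟩ hab hne
    have h1 := (mem_edges.1 h).1
    have h2 := (mem_edges.1 hab).1
    simp only [Matrix.smul_apply, Matrix.vecMulVec_apply, edgeVec, smul_eq_mul, Pi.sub_apply,
      Pi.single_apply]
    simp only [ne_eq, Prod.mk.injEq] at hne h1 h2
    split_ifs <;> first | (exfalso; grind) | simp
  · exact fun h' => (h' h).elim

theorem posSemidef_of_mem {L : Matrix (Fin p) (Fin p) ℝ} (h : L ∈ laplacians E) :
    L.PosSemidef := by
  obtain ⟨w, hw, rfl, -⟩ := h
  exact laplacian_posSemidef hw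

theorem mulVec_one_of_mem {L : Matrix (Fin p) (Fin p) ℝ} (h : L ∈ laplacians E) :
    L *ᵥ 1 = 0 := by
  obtain ⟨w, hw, rfl, -⟩ := h
  exact laplacian_mulVec_one

theorem lambdaTwoPos_of_mem {L : Matrix (Fin p) (Fin p) ℝ} (h : L ∈ laplacians E) :
    LambdaTwoPos L := h.choose_spec.2.2

/-- A connected Laplacian is a Laplacian of every edge set that contains its own edges. -/
theorem mem_laplacians_of_edgeSetOf_le {L : Matrix (Fin p) (Fin p) ℝ}
    (hL : L ∈ laplacians (⊤ : SimpleGraph (Fin p))) (hE : edgeSetOf L ≤ E) : L ∈ laplacians E := by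
  obtain ⟨w, hw, rfl, h2⟩ := hL
  have hsub : edges E ⊆ edges ⊤ := fun e he => by
    have := mem_edges.1 he
    exact mem_edges.2 ⟨this.1, by simpa using this.1.ne⟩
  refine ⟨w, fun e he => hw e (hsub he), ?_, h2⟩
  rw [laplacian, laplacian]
  refine (Finset.sum_subset hsub fun e he hne => ?_).symm
  obtain ⟨i, j⟩ := e
  have hlt := (mem_edges.1 he).1
  by_cases h0 : w (i, j) = 0
  · rw [h0, zero_smul]
  · refine (hne (mem_edges.2 ⟨hlt, hE ?_⟩)).elim
    rw [edgeSetOf, SimpleGraph.fromRel_adj]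
    refine ⟨hlt.ne, Or.inl ?_⟩
    rw [laplacian_apply_of_mem he]
    exact neg_ne_zero.2 h0

/-- Feasibility of the direction -L, valid for t < 1 because a positive multiple of L keeps its
rank. -/
theorem sub_smul_mem_laplacians (hp : 2 ≤ p) {L : Matrix (Fin p) (Fin p) ℝ}
    (hL : L ∈ laplacians E) {t : ℝ} (ht : t < 1) : L + t • (-L) ∈ laplacians E := by
  have hP := posSemidef_of_mem hL
  have e : L + t • (-L) = (1 - t) • L := by module
  obtain ⟨w, hw, hLw, h2⟩ := hL
  have ht' : 0 < 1 - t := by linarith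
  refine ⟨fun x => (1 - t) * w x, fun x hx => mul_nonneg ht'.le (hw x hx), ?_, ?_⟩
  · rw [e, hLw, laplacian, laplacian, Finset.smul_sum]
    simp only [smul_smul]
  · rw [lambdaTwoPos_iff_rank hp hP] at h2
    rw [e, lambdaTwoPos_iff_rank hp (hP.smul ht'.le)]
    refine h2.trans_eq ?_
    have h3 : ((1 - t) • L).mulVecLin = (1 - t) • L.mulVecLin := by
      ext; simp
    rw [Matrix.rank, Matrix.rank, h3, LinearMap.range_smul _ _ ht'.ne']

theorem add_smul_mem_laplacians (hp : 2 ≤ p) {L K : Matrix (Fin p) (Fin p) ℝ}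
    (hL : L ∈ laplacians E) (hK : K ∈ laplacians E) {t : ℝ} (ht : 0 ≤ t) :
    L + t • K ∈ laplacians E := by
  have hP := posSemidef_of_mem hL
  have hQ := posSemidef_of_mem hK
  have h1 := mulVec_one_of_mem hL
  have h1' : (L + t • K) *ᵥ 1 = 0 := by
    rw [Matrix.add_mulVec, Matrix.smul_mulVec, mulVec_one_of_mem hK, h1]; simp
  have hpd := lambdaTwoPos_posDef hp hP h1 (lambdaTwoPos_of_mem hL)
  have h2 : LambdaTwoPos (L + t • K) := by
    rw [lambdaTwoPos_iff_det hp (hP.add (hQ.smul ht)) h1', add_right_comm]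
    exact (hpd.add_posSemidef (hQ.smul ht)).det_pos.ne'
  obtain ⟨w, hw, hLw, -⟩ := hL
  obtain ⟨v, hv, hKv, -⟩ := hK
  refine ⟨fun x => w x + t * v x, fun x hx => add_nonneg (hw x hx) (mul_nonneg ht (hv x hx)),
    ?_, h2⟩
  rw [hLw, hKv, laplacian, laplacian, laplacian, Finset.smul_sum, ← Finset.sum_add_distrib]
  simp only [smul_smul, add_smul]

theorem edgeVec_dotProduct_sampleCov {n : ℕ} (x : Fin n → Fin p → ℝ) (e : Fin p × Fin p) :
    edgeVec e ⬝ᵥ sampleCov x *ᵥ edgeVec e = sampleDist x e.1 e.2 := by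
  rw [sampleCov, sampleDist, Matrix.smul_mulVec, dotProduct_smul, Matrix.sum_mulVec,
    dotProduct_sum, smul_eq_mul]
  congr 1
  refine Finset.sum_congr rfl fun k _ => ?_
  rw [Matrix.vecMulVec_mulVec, edgeVec_dotProduct, dotProduct_comm, edgeVec_dotProduct]
  simp; ring

/-- Effective resistances of a connected graph are positive. -/
theorem edgeVec_dotProduct_pinv_pos (hp : 2 ≤ p) {L : Matrix (Fin p) (Fin p) ℝ}
    (hL : L ∈ laplacians E) {e : Fin p × Fin p} (he : e.1 ≠ e.2) :
    0 < edgeVec e ⬝ᵥ pinv L *ᵥ edgeVec e := by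
  have hpd := lambdaTwoPos_posDef hp (posSemidef_of_mem hL) (mulVec_one_of_mem hL)
    (lambdaTwoPos_of_mem hL)
  rw [pinv_eq hp (posSemidef_of_mem hL) (mulVec_one_of_mem hL) (lambdaTwoPos_of_mem hL),
    Matrix.sub_mulVec, dotProduct_sub]
  have h0 : edgeVec e ⬝ᵥ avg p *ᵥ edgeVec e = 0 := by
    rw [edgeVec_dotProduct]; simp [Matrix.mulVec, dotProduct, avg_apply]
  have hne : edgeVec e ≠ 0 := fun h => by
    have := congrFun h e.1
    simp [edgeVec, he] at this
  rw [h0, sub_zero]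
  simpa using hpd.inv.dotProduct_mulVec_pos hne

/-! ### First-order optimality -/

theorem objective_eq (hp : 2 ≤ p) {L : Matrix (Fin p) (Fin p) ℝ} (hL : L ∈ laplacians E)
    (S : Matrix (Fin p) (Fin p) ℝ) :
    objective S L = -Real.log ((L + avg p).det) + (L * S).trace := by
  rw [objective, pdet_eq_det hp (posSemidef_of_mem hL) (mulVec_one_of_mem hL)
    (lambdaTwoPos_of_mem hL)]

/-- Both sides equal 1 at t = 0, so the inequality passes to right derivatives there, and the
derivative of det(1 + t A) is tr A. -/
theorem trace_le_of_det_le_exp {A : Matrix (Fin p) (Fin p) ℝ} {s : ℝ}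
    (h : ∀ t : ℝ, 0 < t → t < 1 → (1 + t • A).det ≤ Real.exp (t * s)) : A.trace ≤ s := by
  have h1 : HasDerivAt (fun t : ℝ => (1 + t • A).det) A.trace 0 := by
    have e : (fun t : ℝ => (1 + t • A).det) = fun t => 1 + A.trace * t
        + (Matrix.det (1 + (Polynomial.X : Polynomial ℝ) • A.map Polynomial.C)).divX.divX.eval t
          * t ^ 2 := by
      funext t; exact Matrix.det_one_add_smul t A
    rw [e]
    have h2 := (((hasDerivAt_id (0 : ℝ)).const_mul A.trace).const_add 1).add
      (((Matrix.det (1 + (Polynomial.X : Polynomial ℝ)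
        • A.map Polynomial.C)).divX.divX.hasDerivAt (0 : ℝ)).mul (hasDerivAt_pow 2 (0 : ℝ)))
    refine HasDerivAt.congr_deriv h2 ?_
    simp
  have h2 : HasDerivAt (fun t : ℝ => Real.exp (t * s)) s 0 := by
    simpa using ((hasDerivAt_id (0 : ℝ)).mul_const s).exp
  have h3 := (h2.sub h1).tendsto_slope_zero_right
  rw [← sub_nonneg]
  refine ge_of_tendsto h3 ?_
  filter_upwards [Ioo_mem_nhdsGT (zero_lt_one' ℝ)] with t ht
  have := h t ht.1 ht.2
  simp only [Pi.sub_apply, zero_add, zero_mul, Real.exp_zero, zero_smul, add_zero, Matrix.det_one,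
    sub_self, sub_zero, smul_eq_mul]
  exact mul_nonneg (inv_nonneg.2 ht.1.le) (sub_nonneg.2 this)

/-- One-sided stationarity: the derivative of the objective along D is tr(D S) - tr(D L†). Factoring
out det(L + J) reduces the determinant to det(1 + t (L + J)⁻¹ D). -/
theorem IsCGLE.trace_le (hp : 2 ≤ p) {S L D : Matrix (Fin p) (Fin p) ℝ} (hL : IsCGLE E S L)
    (hD : ∀ t : ℝ, 0 < t → t < 1 → L + t • D ∈ laplacians E) (hD1 : D *ᵥ 1 = 0) :
    (D * pinv L).trace ≤ (D * S).trace := by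
  have hP := posSemidef_of_mem hL.1
  have h1 := mulVec_one_of_mem hL.1
  have h2 := lambdaTwoPos_of_mem hL.1
  have hpd := lambdaTwoPos_posDef hp hP h1 h2
  rw [pinv_eq hp hP h1 h2, mul_sub, mul_avg_eq_zero hD1, sub_zero, Matrix.trace_mul_comm]
  refine trace_le_of_det_le_exp fun t ht ht1 => ?_
  have hmem := hD t ht ht1
  have hpd' := lambdaTwoPos_posDef hp (posSemidef_of_mem hmem) (mulVec_one_of_mem hmem)
    (lambdaTwoPos_of_mem hmem)
  have hle := hL.2 _ hmem
  rw [objective_eq hp hL.1, objective_eq hp hmem, add_mul, Matrix.trace_add, smul_mul_assoc,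
    Matrix.trace_smul, smul_eq_mul] at hle
  have hdet : (L + t • D + avg p).det
      = (L + avg p).det * (1 + t • ((L + avg p)⁻¹ * D)).det := by
    rw [← Matrix.det_mul, mul_add, mul_one, mul_smul_comm, ← mul_assoc,
      Matrix.mul_nonsing_inv _ (isUnit_iff_ne_zero.2 hpd.det_pos.ne'), one_mul, add_right_comm]
  have hpos : 0 < (1 + t • ((L + avg p)⁻¹ * D)).det := by
    have := hpd'.det_pos
    rw [hdet] at this
    exact pos_of_mul_pos_right this hpd.det_pos.le
  rw [hdet, Real.log_mul hpd.det_pos.ne' hpos.ne'] at hle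
  rw [← Real.log_le_iff_le_exp hpos]
  linarith

/-! ### The loss bound -/

theorem symSteinLoss_eq (L K : Matrix (Fin p) (Fin p) ℝ) :
    symSteinLoss L K
      = (((L * pinv K).trace + (K * pinv L).trace) / ((p : ℝ) - 1) - 2) / 2 := by
  rw [symSteinLoss, steinLoss, steinLoss]
  ring

theorem IsCGLE.symSteinLoss_le (hp : 2 ≤ p) {S L K : Matrix (Fin p) (Fin p) ℝ} {δ : ℝ}
    (hδ0 : 0 ≤ δ) (hδ : δ ≤ 1 / 2) (hL : IsCGLE E S L) (hK : K ∈ laplacians E)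
    (hS : ∀ e ∈ edges E, |edgeVec e ⬝ᵥ S *ᵥ edgeVec e - edgeVec e ⬝ᵥ pinv K *ᵥ edgeVec e|
      ≤ δ * (edgeVec e ⬝ᵥ pinv K *ᵥ edgeVec e)) :
    symSteinLoss L K ≤ 3 / 2 * δ := by
  have hp1 : (0 : ℝ) < p - 1 := by
    have : (2 : ℝ) ≤ p := by exact_mod_cast hp
    linarith
  have hLS : (L * S).trace ≤ p - 1 := by
    have h := hL.trace_le hp (D := -L) (fun t _ ht1 => sub_smul_mem_laplacians hp hL.1 ht1)
      (by rw [Matrix.neg_mulVec, mulVec_one_of_mem hL.1, neg_zero])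
    rw [neg_mul, neg_mul, Matrix.trace_neg, Matrix.trace_neg, trace_mul_pinv_self hp
      (posSemidef_of_mem hL.1) (mulVec_one_of_mem hL.1) (lambdaTwoPos_of_mem hL.1)] at h
    linarith
  have hKL := hL.trace_le hp (D := K)
    (fun t ht _ => add_smul_mem_laplacians hp hL.1 hK ht.le) (mulVec_one_of_mem hK)
  have hKS : (K * S).trace ≤ (1 + δ) * (p - 1) := by
    rw [← trace_mul_pinv_self hp (posSemidef_of_mem hK) (mulVec_one_of_mem hK)
      (lambdaTwoPos_of_mem hK)]
    obtain ⟨w, hw, hKw, -⟩ := hK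
    generalize pinv K = R at *
    rw [hKw, trace_laplacian_mul, trace_laplacian_mul, Finset.mul_sum]
    refine Finset.sum_le_sum fun e he => ?_
    have := (abs_le.1 (hS e he)).2
    nlinarith [hw e he]
  have hLK : (1 - δ) * (L * pinv K).trace ≤ (L * S).trace := by
    obtain ⟨w, hw, hLw, -⟩ := hL.1
    generalize pinv K = R at *
    rw [hLw, trace_laplacian_mul, trace_laplacian_mul, Finset.mul_sum]
    refine Finset.sum_le_sum fun e he => ?_
    have := (abs_le.1 (hS e he)).1
    nlinarith [hw e he]
  -- (1 - δ)(1 + 2δ) = 1 + δ(1 - 2δ) ≥ 1; this is where δ ≤ 1/2 enters.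
  have hLK' : (L * pinv K).trace ≤ (1 + 2 * δ) * (p - 1) := by
    have h1 : (1 - δ) * (L * pinv K).trace ≤ (1 - δ) * ((1 + 2 * δ) * (p - 1)) := by
      nlinarith [mul_nonneg (mul_nonneg hδ0 (by linarith : 0 ≤ 1 - 2 * δ)) hp1.le]
    exact le_of_mul_le_mul_left h1 (by linarith)
  rw [symSteinLoss_eq]
  have : ((L * pinv K).trace + (K * pinv L).trace) / ((p : ℝ) - 1) ≤ 2 + 3 * δ := by
    rw [div_le_iff₀ hp1]; linarith
  linarith

/-! ### Existence of the estimator -/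

theorem trace_laplacian : (laplacian E w).trace = 2 * ∑ e ∈ edges E, w e := by
  have h := trace_laplacian_mul (E := E) (w := w) 1
  rw [mul_one] at h
  rw [h, Finset.mul_sum]
  refine Finset.sum_congr rfl fun e he => ?_
  have hne := (mem_edges.1 he).1.ne
  rw [Matrix.one_mulVec, edgeVec_dotProduct]
  simp [edgeVec, hne, hne.symm]; ring

theorem _root_.Matrix.PosSemidef.det_le_trace_pow {A : Matrix (Fin p) (Fin p) ℝ}
    (hA : A.PosSemidef) : A.det ≤ A.trace ^ p := by
  rw [hA.1.det_eq_prod_eigenvalues, hA.1.trace_eq_sum_eigenvalues]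
  simp only [RCLike.ofReal_real_eq_id, id_eq]
  calc ∏ i, hA.1.eigenvalues i ≤ ∏ _i : Fin p, ∑ j, hA.1.eigenvalues j :=
        Finset.prod_le_prod (fun i _ => hA.eigenvalues_nonneg i) fun i _ =>
          Finset.single_le_sum (fun j _ => hA.eigenvalues_nonneg j) (Finset.mem_univ i)
    _ = _ := by simp

theorem tendsto_affine_pow_mul_exp_neg {c : ℝ} (hc : 0 < c) (m : ℕ) :
    Filter.Tendsto (fun s : ℝ => (2 * s + 1) ^ m * Real.exp (-c * s)) Filter.atTop (nhds 0) := by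
  have hu : Filter.Tendsto (fun s : ℝ => c / 2 * (2 * s + 1)) Filter.atTop Filter.atTop :=
    Filter.Tendsto.const_mul_atTop (by linarith) <| Filter.tendsto_atTop_add_const_right _ _ <|
      Filter.Tendsto.const_mul_atTop (by norm_num) Filter.tendsto_id
  have h := ((Real.tendsto_pow_mul_exp_neg_atTop_nhds_zero m).comp hu).const_mul
    ((2 / c) ^ m * Real.exp (c / 2))
  rw [mul_zero] at h
  refine h.congr fun s => ?_
  have e1 : Real.exp (-c * s) = Real.exp (c / 2) * Real.exp (-(c / 2 * (2 * s + 1))) := by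
    rw [← Real.exp_add]; congr 1; ring
  have e2 : (2 * s + 1) ^ m = (2 / c) ^ m * (c / 2 * (2 * s + 1)) ^ m := by
    rw [← mul_pow]; congr 1; field_simp
  simp only [Function.comp]
  rw [e1, e2]; ring

theorem continuous_laplacian : Continuous fun w : Fin p × Fin p → ℝ => laplacian E w := by
  unfold laplacian
  fun_prop

/-- Connectedness is not a closed condition, so instead of the objective one maximizes
exp(-objective), in the form det(L + J) exp(-tr(L S)). It is continuous in all weights and vanishes
at disconnected graphs. Positive edge forms of S make it decay as the total weight grows. -/
theorem exists_isCGLE (hp : 2 ≤ p) {S K : Matrix (Fin p) (Fin p) ℝ} (hK : K ∈ laplacians E)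
    (hS : ∀ e ∈ edges E, 0 < edgeVec e ⬝ᵥ S *ᵥ edgeVec e) : ∃ L, IsCGLE E S L := by
  classical
  obtain ⟨c, hc, hcS⟩ : ∃ c : ℝ, 0 < c ∧ ∀ e ∈ edges E, c ≤ edgeVec e ⬝ᵥ S *ᵥ edgeVec e := by
    rcases (edges E).eq_empty_or_nonempty with h | h
    · exact ⟨1, one_pos, by simp [h]⟩
    · obtain ⟨e, he, hmin⟩ := (edges E).exists_min_image
        (fun e => edgeVec e ⬝ᵥ S *ᵥ edgeVec e) h
      exact ⟨_, hS e he, hmin⟩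
  set g : (Fin p × Fin p → ℝ) → ℝ := fun w =>
    (laplacian E w + avg p).det * Real.exp (-(laplacian E w * S).trace) with hg
  have hgcont : Continuous g := by
    have := continuous_laplacian (E := E)
    fun_prop
  have hgbd : ∀ w : Fin p × Fin p → ℝ, (∀ e ∈ edges E, 0 ≤ w e) →
      g w ≤ (2 * ∑ e ∈ edges E, w e + 1) ^ p * Real.exp (-c * ∑ e ∈ edges E, w e) := by
    intro w hw
    have hP := (laplacian_posSemidef hw).add (avg_posSemidef p)
    have h1 := hP.det_le_trace_pow
    rw [Matrix.trace_add, trace_laplacian, trace_avg (by omega)] at h1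
    refine mul_le_mul h1 (Real.exp_le_exp.2 ?_) (Real.exp_pos _).le (hP.det_nonneg.trans h1)
    rw [neg_mul, neg_le_neg_iff, trace_laplacian_mul, Finset.mul_sum]
    exact Finset.sum_le_sum fun e he => by nlinarith [hw e he, hcS e he]
  have hobj : ∀ L ∈ laplacians E, ∀ w : Fin p × Fin p → ℝ, L = laplacian E w →
      objective S L = -Real.log (g w) ∧ 0 < g w := by
    rintro L hL w rfl
    have hpd := lambdaTwoPos_posDef hp (posSemidef_of_mem hL) (mulVec_one_of_mem hL)
      (lambdaTwoPos_of_mem hL)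
    refine ⟨?_, mul_pos hpd.det_pos (Real.exp_pos _)⟩
    rw [objective_eq hp hL, hg, Real.log_mul hpd.det_pos.ne' (Real.exp_pos _).ne', Real.log_exp]
    ring
  obtain ⟨v, hv, hKv, -⟩ := id hK
  have hgv := (hobj K hK v hKv).2
  -- R bounds the total weight of every competitor at least as good as K, so a compact box suffices.
  obtain ⟨R, hR⟩ := Filter.eventually_atTop.1
    ((tendsto_affine_pow_mul_exp_neg hc p).eventually_lt_const hgv)
  have hlarge : ∀ w : Fin p × Fin p → ℝ, (∀ e ∈ edges E, 0 ≤ w e) → g v ≤ g w →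
      ∑ e ∈ edges E, w e ≤ R := by
    intro w hw hgw
    by_contra hlt
    exact absurd (hgw.trans (hgbd w hw)) (not_le.2 (hR _ (not_le.1 hlt).le))
  have hR0 : 0 ≤ R := (Finset.sum_nonneg hv).trans (hlarge v hv le_rfl)
  obtain ⟨w, hwK, hmax⟩ := (isCompact_Icc (a := (0 : Fin p × Fin p → ℝ))
    (b := fun _ => R)).exists_isMaxOn (Set.nonempty_Icc.2 fun _ => hR0) hgcont.continuousOn
  have hmax' : ∀ u : Fin p × Fin p → ℝ, (∀ e ∈ edges E, 0 ≤ u e) → g v ≤ g u → g u ≤ g w := by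
    intro u hu hgu
    have hs := hlarge u hu hgu
    -- Weights off `edges E` are unconstrained but irrelevant; zeroing them puts u in the box.
    have e : g u = g fun x => if x ∈ edges E then u x else 0 := by
      simp only [hg]
      rw [laplacian_congr (E := E) (w := u) (w' := fun x => if x ∈ edges E then u x else 0)
        fun x hx => by simp [hx]]
    rw [e]
    refine hmax ⟨fun x => ?_, fun x => ?_⟩
    · by_cases hx : x ∈ edges E
      · simpa [hx] using hu x hx
      · simp [hx]
    · by_cases hx : x ∈ edges E
      · simpa [hx] using (Finset.single_le_sum hu hx).trans hs
      · simpa [hx] using hR0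
  have hgw : g v ≤ g w := hmax' v hv le_rfl
  have hw0 : ∀ e ∈ edges E, 0 ≤ w e := fun e _ => hwK.1 e
  -- The maximum is at least g v > 0, so the maximizer is connected.
  have hdet : (laplacian E w + avg p).det ≠ 0 := by
    intro h0
    have : g w = 0 := by simp [hg, h0]
    linarith
  have hmem : laplacian E w ∈ laplacians E :=
    ⟨w, hw0, rfl, (lambdaTwoPos_iff_det hp (laplacian_posSemidef hw0) laplacian_mulVec_one).2 hdet⟩
  refine ⟨_, hmem, fun L hL => ?_⟩
  obtain ⟨u, hu, hLu, -⟩ := id hL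
  obtain ⟨h1, h1'⟩ := hobj L hL u hLu
  obtain ⟨h2, h2'⟩ := hobj _ hmem w rfl
  rw [h1, h2, neg_le_neg_iff]
  refine Real.log_le_log h1' ?_
  rcases le_total (g v) (g u) with h | h
  · exact hmax' u hu h
  · exact h.trans hgw

end

/-! ### A Bernstein inequality -/

theorem exp_le_one_add_add_sq_mul_exp_abs (x : ℝ) :
    Real.exp x ≤ 1 + x + x ^ 2 * Real.exp |x| := by
  have h1 : Real.exp x - 1 ≤ x * Real.exp x := by
    have h := mul_le_mul_of_nonneg_right (Real.add_one_le_exp (-x)) (Real.exp_pos x).le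
    rw [← Real.exp_add, neg_add_cancel, Real.exp_zero] at h
    linarith
  rcases le_total 0 x with hx | hx
  · rw [abs_of_nonneg hx]
    nlinarith [mul_le_mul_of_nonneg_left (Real.add_one_le_exp x) hx,
      mul_nonneg hx (sub_nonneg.2 (Real.add_one_le_exp x)),
      mul_le_mul_of_nonneg_left h1 hx]
  · rw [abs_of_nonpos hx]
    have h2 : Real.exp x ≤ 1 + x + x ^ 2 := by
      have h3 := mul_le_mul_of_nonpos_left (Real.add_one_le_exp x) hx
      linarith
    have h4 : 1 ≤ Real.exp (-x) := Real.one_le_exp (by linarith)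
    nlinarith [mul_le_mul_of_nonneg_left h4 (sq_nonneg x)]

/-- The variance proxy of a nonnegative variable `Z` of mean one with `E exp(a Z) ≤ 2`. -/
def varianceProxy (a : ℝ) : ℝ := 16 * Real.exp a / a ^ 2

theorem varianceProxy_pos {a : ℝ} (ha : 0 < a) : 0 < varianceProxy a := by
  unfold varianceProxy; positivity

section

variable {Ω : Type*} [MeasurableSpace Ω] {μ : Measure Ω} {a : ℝ}

theorem integrable_exp_mul_sub_one {Z : Ω → ℝ} (hZ : AEMeasurable Z μ) (h0 : ∀ ω, 0 ≤ Z ω)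
    (hint : Integrable (fun ω => Real.exp (a * Z ω)) μ) {t : ℝ} (ht : |t| ≤ a) :
    Integrable (fun ω => Real.exp (t * (Z ω - 1))) μ := by
  refine Integrable.mono' (hint.const_mul (Real.exp (-t)))
    ((hZ.sub_const 1).const_mul t).exp.aestronglyMeasurable (Filter.Eventually.of_forall fun ω => ?_)
  rw [Real.norm_eq_abs, Real.abs_exp, ← Real.exp_add, Real.exp_le_exp]
  nlinarith [mul_le_mul_of_nonneg_right ((le_abs_self t).trans ht) (h0 ω)]

/-- The mean-one condition kills the linear term of the exponential bound. With W = Z - 1, half of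
exp(a|W|) absorbs W² and the other half absorbs exp|tW|; |W| ≤ Z + 1 then costs the factor exp a. -/
theorem mgf_sub_one_le [IsProbabilityMeasure μ] (ha : 0 < a) {Z : Ω → ℝ} (hZ : AEMeasurable Z μ)
    (h0 : ∀ ω, 0 ≤ Z ω) (hint : Integrable (fun ω => Real.exp (a * Z ω)) μ)
    (h2 : ∫ ω, Real.exp (a * Z ω) ∂μ ≤ 2) (h1 : ∫ ω, Z ω ∂μ = 1) {t : ℝ} (ht : |t| ≤ a / 2) :
    mgf (fun ω => Z ω - 1) μ t ≤ Real.exp (varianceProxy a * t ^ 2) := by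
  have hZint : Integrable Z μ := by
    refine Integrable.mono' (hint.const_mul a⁻¹) hZ.aestronglyMeasurable
      (Filter.Eventually.of_forall fun ω => ?_)
    rw [Real.norm_eq_abs, abs_of_nonneg (h0 ω), inv_mul_eq_div, le_div_iff₀ ha]
    linarith [Real.add_one_le_exp (a * Z ω)]
  have hpt : ∀ ω, Real.exp (t * (Z ω - 1))
      ≤ 1 + t * (Z ω - 1) + t ^ 2 * (8 / a ^ 2 * Real.exp a) * Real.exp (a * Z ω) := by
    intro ω
    set W := Z ω - 1 with hW
    have hWabs : |W| ≤ Z ω + 1 := by rw [abs_le]; constructor <;> linarith [h0 ω]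
    have e1 := exp_le_one_add_add_sq_mul_exp_abs (t * W)
    -- This is y²/2 ≤ exp y at y = a|W|/2.
    have e2 : W ^ 2 ≤ 8 / a ^ 2 * Real.exp (a / 2 * |W|) := by
      have h := Real.quadratic_le_exp_of_nonneg (x := a / 2 * |W|) (by positivity)
      rw [div_mul_eq_mul_div, le_div_iff₀ (by positivity)]
      have h3 : 0 ≤ a / 2 * |W| := by positivity
      have h4 : (a / 2 * |W|) ^ 2 = a ^ 2 * W ^ 2 / 4 := by rw [mul_pow, sq_abs]; ring
      nlinarith
    have e3 : W ^ 2 * Real.exp |t * W| ≤ 8 / a ^ 2 * Real.exp a * Real.exp (a * Z ω) := by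
      calc W ^ 2 * Real.exp |t * W|
          ≤ 8 / a ^ 2 * Real.exp (a / 2 * |W|) * Real.exp (a / 2 * |W|) := by
            refine mul_le_mul e2 (Real.exp_le_exp.2 ?_) (Real.exp_pos _).le (by positivity)
            rw [abs_mul]
            exact mul_le_mul_of_nonneg_right ht (abs_nonneg _)
        _ = 8 / a ^ 2 * Real.exp (a * |W|) := by
            rw [mul_assoc, ← Real.exp_add]; ring_nf
        _ ≤ 8 / a ^ 2 * Real.exp (a + a * Z ω) := by
            gcongr
            nlinarith
        _ = _ := by rw [Real.exp_add, mul_assoc]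
    have e4 := mul_le_mul_of_nonneg_left e3 (sq_nonneg t)
    calc _ ≤ _ := e1
      _ = 1 + t * W + t ^ 2 * (W ^ 2 * Real.exp |t * W|) := by ring
      _ ≤ _ := by rw [mul_assoc (t ^ 2)]; linarith
  have hlin₀ : Integrable (fun ω => t * (Z ω - 1)) μ :=
    (hZint.sub (integrable_const _)).const_mul t
  have hlin : Integrable (fun ω => 1 + t * (Z ω - 1)) μ := (integrable_const _).add hlin₀
  have hle : mgf (fun ω => Z ω - 1) μ t ≤ ∫ ω, (1 + t * (Z ω - 1)
      + t ^ 2 * (8 / a ^ 2 * Real.exp a) * Real.exp (a * Z ω)) ∂μ :=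
    integral_mono (integrable_exp_mul_sub_one hZ h0 hint (by linarith))
      (hlin.add (hint.const_mul _)) hpt
  rw [integral_add hlin (hint.const_mul _), integral_add (integrable_const _)
    hlin₀, integral_const_mul, integral_const_mul,
    integral_sub hZint (integrable_const _), h1] at hle
  simp only [integral_const, probReal_univ, smul_eq_mul, mul_one, sub_self, mul_zero,
    add_zero] at hle
  have h3 : t ^ 2 * (8 / a ^ 2 * Real.exp a) * ∫ ω, Real.exp (a * Z ω) ∂μ
      ≤ varianceProxy a * t ^ 2 := by
    calc _ ≤ t ^ 2 * (8 / a ^ 2 * Real.exp a) * 2 := by gcongr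
      _ = _ := by unfold varianceProxy; ring
  linarith [Real.add_one_le_exp (varianceProxy a * t ^ 2)]

theorem measureReal_abs_mean_sub_one_ge_le [IsProbabilityMeasure μ] (ha : 0 < a) {n : ℕ}
    (hn : 0 < n) {Z : Fin n → Ω → ℝ} (hind : iIndepFun Z μ) (hZ : ∀ k, AEMeasurable (Z k) μ)
    (h0 : ∀ k ω, 0 ≤ Z k ω) (hint : ∀ k, Integrable (fun ω => Real.exp (a * Z k ω)) μ)
    (h2 : ∀ k, ∫ ω, Real.exp (a * Z k ω) ∂μ ≤ 2) (h1 : ∀ k, ∫ ω, Z k ω ∂μ = 1) {δ : ℝ}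
    (hδ0 : 0 ≤ δ) (hδ : δ ≤ a * varianceProxy a) :
    μ.real {ω | δ ≤ |(n : ℝ)⁻¹ * ∑ k, Z k ω - 1|}
      ≤ 2 * Real.exp (-(n * δ ^ 2 / (4 * varianceProxy a))) := by
  set D := varianceProxy a with hD
  have hDpos : 0 < D := varianceProxy_pos ha
  have hn' : (0 : ℝ) < n := by exact_mod_cast hn
  set W : Fin n → Ω → ℝ := fun k ω => Z k ω - 1 with hW
  have hWind : iIndepFun W μ :=
    hind.comp (fun _ x => x - 1) fun _ => measurable_id.sub_const 1
  have hWm : ∀ k, AEMeasurable (W k) μ := fun k => (hZ k).sub_const 1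
  have key : ∀ t : ℝ, |t| ≤ a / 2 →
      Integrable (fun ω => Real.exp (t * (∑ k, W k) ω)) μ ∧
        mgf (∑ k, W k) μ t ≤ Real.exp (n * (D * t ^ 2)) := by
    intro t ht
    have hi := fun k => integrable_exp_mul_sub_one (hZ k) (h0 k) (hint k) (t := t) (by linarith)
    have hprod := hWind.mgf_sum₀ (t := t) hWm Finset.univ
    constructor
    -- A non-integrable exponential would give `mgf` its default value 0, against a product of
    -- positive factors.
    · by_contra hni
      have hz : mgf (∑ k, W k) μ t = 0 := integral_undef hni
      rw [hz] at hprod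
      exact (Finset.prod_pos fun k _ => mgf_pos (hi k)).ne hprod
    · rw [hprod]
      calc ∏ k, mgf (W k) μ t ≤ ∏ _k : Fin n, Real.exp (D * t ^ 2) :=
            Finset.prod_le_prod (fun k _ => mgf_nonneg) fun k _ =>
              mgf_sub_one_le ha (hZ k) (h0 k) (hint k) (h2 k) (h1 k) ht
        _ = _ := by rw [Finset.prod_const, Finset.card_univ, Fintype.card_fin, ← Real.exp_nat_mul]
  -- The minimizer of -sδ + D s²; the admissible range s ≤ a/2 is the hypothesis δ ≤ aD.
  set s := δ / (2 * D) with hs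
  have hs0 : 0 ≤ s := by positivity
  have hsa : |s| ≤ a / 2 := by
    rw [abs_of_nonneg hs0, hs, div_le_iff₀ (by positivity)]; linarith
  have hexp : -s * (n * δ) + n * (D * s ^ 2) = -(n * δ ^ 2 / (4 * D)) := by
    rw [hs]; field_simp; ring
  have hup : μ.real {ω | n * δ ≤ (∑ k, W k) ω} ≤ Real.exp (-(n * δ ^ 2 / (4 * D))) := by
    obtain ⟨hi, hm⟩ := key s hsa
    refine (measure_ge_le_exp_mul_mgf (n * δ) hs0 hi).trans ?_
    rw [← hexp, Real.exp_add]
    exact mul_le_mul_of_nonneg_left hm (Real.exp_pos _).le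
  have hlo : μ.real {ω | (∑ k, W k) ω ≤ -(n * δ)} ≤ Real.exp (-(n * δ ^ 2 / (4 * D))) := by
    obtain ⟨hi, hm⟩ := key (-s) (by rwa [abs_neg])
    refine (measure_le_le_exp_mul_mgf (-(n * δ)) (neg_nonpos.2 hs0) hi).trans ?_
    rw [← hexp, Real.exp_add, neg_neg, mul_neg, ← neg_mul]
    rw [neg_sq] at hm
    exact mul_le_mul_of_nonneg_left hm (Real.exp_pos _).le
  have hsub : {ω | δ ≤ |(n : ℝ)⁻¹ * ∑ k, Z k ω - 1|}
      ⊆ {ω | n * δ ≤ (∑ k, W k) ω} ∪ {ω | (∑ k, W k) ω ≤ -(n * δ)} := by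
    intro ω hω
    have e : (∑ k, W k) ω = n * ((n : ℝ)⁻¹ * ∑ k, Z k ω - 1) := by
      simp only [Finset.sum_apply, hW, Finset.sum_sub_distrib, Finset.sum_const, Finset.card_univ,
        Fintype.card_fin, nsmul_eq_mul, mul_one]
      field_simp
    simp only [Set.mem_union, Set.mem_ofPred_eq, e] at hω ⊢
    rcases le_abs'.1 hω with h | h
    · right; nlinarith
    · left; nlinarith
  calc _ ≤ μ.real ({ω | n * δ ≤ (∑ k, W k) ω} ∪ {ω | (∑ k, W k) ω ≤ -(n * δ)}) :=
        measureReal_mono hsub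
    _ ≤ _ := measureReal_union_le _ _
    _ ≤ _ := by linarith

end

/-! ### Concentration of the sample distances -/

section

variable {p : ℕ} {P : Measure (Fin p → ℝ)} {Sig : Matrix (Fin p) (Fin p) ℝ} {c₀ c₁ : ℝ}

theorem lintegral_exp_sq_div_le_two {α : Type*} [MeasurableSpace α] {P : Measure α} {Y : α → ℝ}
    {K : ℝ} (hK : psiTwoNorm P Y < ENNReal.ofReal K) :
    ∫⁻ x, ENNReal.ofReal (Real.exp (Y x ^ 2 / K ^ 2)) ∂P ≤ 2 := by
  obtain ⟨_, ⟨K', hK', hle, rfl⟩, hlt⟩ := sInf_lt_iff.1 hK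
  have hKK : K' < K := (ENNReal.ofReal_lt_ofReal_iff_of_nonneg hK'.le).1 hlt
  refine (lintegral_mono fun x => ?_).trans hle
  gcongr

theorem IsSubGaussianLaw.integral_edgeVec_sq [IsProbabilityMeasure P]
    (h : IsSubGaussianLaw P Sig c₀ c₁) (e : Fin p × Fin p) :
    ∫ x, (edgeVec e ⬝ᵥ x) ^ 2 ∂P = edgeVec e ⬝ᵥ Sig *ᵥ edgeVec e := by
  have hcov : ∀ i j, ∫ x : Fin p → ℝ, x i * x j ∂P = Sig i j := fun i j => by
    rw [← h.covariance i j, covariance_eq_sub (h.memLp i) (h.memLp j), h.mean i, h.mean j]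
    simp
  have hint : ∀ i j, Integrable (fun x : Fin p → ℝ => x i * x j) P := fun i j =>
    (h.memLp i).integrable_mul (h.memLp j)
  have e1 : ∀ x : Fin p → ℝ, (edgeVec e ⬝ᵥ x) ^ 2
      = x e.1 * x e.1 - x e.1 * x e.2 - x e.2 * x e.1 + x e.2 * x e.2 := fun x => by
    rw [edgeVec_dotProduct]; ring
  simp_rw [e1]
  have i1 : Integrable (fun x : Fin p → ℝ => x e.1 * x e.1 - x e.1 * x e.2) P :=
    (hint _ _).sub (hint _ _)
  have i2 : Integrable (fun x : Fin p → ℝ => x e.1 * x e.1 - x e.1 * x e.2 - x e.2 * x e.1) P :=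
    i1.sub (hint _ _)
  rw [integral_add i2 (hint _ _), integral_sub i1 (hint _ _), integral_sub (hint _ _) (hint _ _)]
  simp only [hcov, edgeVec_dotProduct]
  rw [edgeVec, Matrix.mulVec_sub]
  simp
  ring

/-- Taking K² = 2r/c₁ puts K strictly above the ψ₂ norm, so the infimum need not be attained; the
factor 2 turns c₁ into c₁/2. -/
theorem IsSubGaussianLaw.lintegral_exp_le_two [IsProbabilityMeasure P] (hc₁ : 0 < c₁)
    (h : IsSubGaussianLaw P Sig c₀ c₁) (e : Fin p × Fin p)
    (hr : 0 < edgeVec e ⬝ᵥ Sig *ᵥ edgeVec e) :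
    ∫⁻ x, ENNReal.ofReal (Real.exp (c₁ / 2 *
      ((edgeVec e ⬝ᵥ x) ^ 2 / (edgeVec e ⬝ᵥ Sig *ᵥ edgeVec e)))) ∂P ≤ 2 := by
  have h2 := h.psiTwo_sq_le (edgeVec e)
  rw [h.integral_edgeVec_sq e] at h2
  set r := edgeVec e ⬝ᵥ Sig *ᵥ edgeVec e with hrdef
  set K := √(2 * r / c₁) with hK
  have hK2 : K ^ 2 = 2 * r / c₁ := Real.sq_sqrt (by positivity)
  have hlt : psiTwoNorm P (fun x => edgeVec e ⬝ᵥ x) < ENNReal.ofReal K := by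
    rw [← ENNReal.pow_lt_pow_left_iff two_ne_zero, ← ENNReal.ofReal_pow (Real.sqrt_nonneg _), hK2]
    refine h2.trans_lt ((ENNReal.ofReal_lt_ofReal_iff (by positivity)).2 ?_)
    gcongr
    linarith
  refine le_trans (le_of_eq ?_) (lintegral_exp_sq_div_le_two hlt)
  congr 1
  funext x
  rw [hK2]
  congr 2
  field_simp

/-- Dividing (g_eᵀ x)² by its mean r gives a mean-one variable whose exponential moment depends on
c₁ alone, so the Bernstein bound is uniform in L and e. -/
theorem IsSubGaussianSample.measureReal_sampleDist_le {n : ℕ} (hn : 0 < n) {Ω : Type*}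
    [MeasurableSpace Ω] {μ : Measure Ω} [IsProbabilityMeasure μ] {X : Fin n → Ω → Fin p → ℝ}
    {L : Matrix (Fin p) (Fin p) ℝ} (hc₁ : 0 < c₁) (h : IsSubGaussianSample μ X L c₀ c₁)
    (e : Fin p × Fin p) (hr : 0 < edgeVec e ⬝ᵥ pinv L *ᵥ edgeVec e) {δ : ℝ} (hδ0 : 0 ≤ δ)
    (hδ : δ ≤ c₁ / 2 * varianceProxy (c₁ / 2)) :
    μ.real {ω | δ * (edgeVec e ⬝ᵥ pinv L *ᵥ edgeVec e)
        < |sampleDist (fun k => X k ω) e.1 e.2 - edgeVec e ⬝ᵥ pinv L *ᵥ edgeVec e|}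
      ≤ 2 * Real.exp (-(n * δ ^ 2 / (4 * varianceProxy (c₁ / 2)))) := by
  obtain ⟨P, hP, hlaw⟩ := h.law
  have hPprob : IsProbabilityMeasure P := by
    rw [← (hlaw ⟨0, hn⟩).map_eq]
    exact Measure.isProbabilityMeasure_map (hlaw ⟨0, hn⟩).aemeasurable
  have hexp := hP.lintegral_exp_le_two hc₁ e hr
  have hsq := hP.integral_edgeVec_sq e
  set r := edgeVec e ⬝ᵥ pinv L *ᵥ edgeVec e with hrdef
  set f : (Fin p → ℝ) → ℝ := fun x => (edgeVec e ⬝ᵥ x) ^ 2 / r with hf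
  have hfm : Measurable f := by
    simp only [hf, edgeVec_dotProduct]
    fun_prop
  set a := c₁ / 2 with ha
  have ha0 : 0 < a := by positivity
  have hem : Measurable fun x => Real.exp (a * f x) := (hfm.const_mul a).exp
  have hXl : ∀ k, ∫⁻ ω, ENNReal.ofReal (Real.exp (a * f (X k ω))) ∂μ ≤ 2 := fun k => by
    rw [(hlaw k).lintegral_comp (f := fun x => ENNReal.ofReal (Real.exp (a * f x)))
      hem.ennreal_ofReal.aemeasurable]
    exact hexp
  have hZm : ∀ k, AEMeasurable (fun ω => f (X k ω)) μ := fun k =>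
    hfm.comp_aemeasurable (hlaw k).aemeasurable
  have hXem : ∀ k, AEStronglyMeasurable (fun ω => Real.exp (a * f (X k ω))) μ := fun k =>
    (hem.comp_aemeasurable (hlaw k).aemeasurable).aestronglyMeasurable
  refine (measureReal_mono ?_).trans (measureReal_abs_mean_sub_one_ge_le ha0 hn
    (Z := fun k ω => f (X k ω)) (h.indep.comp (fun _ => f) fun _ => hfm) hZm
    (fun k ω => by simp only [hf]; positivity)
    (fun k => ⟨hXem k, ?_⟩) (fun k => ?_) (fun k => ?_) hδ0 hδ)
  · intro ω hω
    have e1 : sampleDist (fun k => X k ω) e.1 e.2 - r = r * ((n : ℝ)⁻¹ * ∑ k, f (X k ω) - 1) := by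
      simp only [hf, edgeVec_dotProduct, sampleDist, ← Finset.sum_div]
      field_simp
    simp only [Set.mem_ofPred_eq, e1, abs_mul, abs_of_pos hr] at hω ⊢
    nlinarith
  · rw [hasFiniteIntegral_iff_ofReal (Filter.Eventually.of_forall fun _ => (Real.exp_pos _).le)]
    exact (hXl k).trans_lt (by simp)
  · rw [integral_eq_lintegral_of_nonneg_ae
      (Filter.Eventually.of_forall fun _ => (Real.exp_pos _).le) (hXem k)]
    exact ENNReal.toReal_le_of_le_ofReal (by norm_num) (by simpa using hXl k)
  · have := (hlaw k).integral_comp (f := f) hfm.aestronglyMeasurable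
    simp only [Function.comp_def] at this
    rw [this]
    simp only [hf]
    rw [integral_div, hsq, div_self hr.ne']

theorem IsSubGaussianSample.measureReal_biUnion_sampleDist_le {n : ℕ} (hp : 2 ≤ p) (hn : 0 < n)
    {Ω : Type*} [MeasurableSpace Ω] {μ : Measure Ω} [IsProbabilityMeasure μ]
    {X : Fin n → Ω → Fin p → ℝ} {L : Matrix (Fin p) (Fin p) ℝ}
    (hL : L ∈ laplacians (⊤ : SimpleGraph (Fin p))) (hc₁ : 0 < c₁)
    (h : IsSubGaussianSample μ X L c₀ c₁) {δ : ℝ} (hδ0 : 0 ≤ δ)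
    (hδ : δ ≤ c₁ / 2 * varianceProxy (c₁ / 2))
    (hδn : n * δ ^ 2 = 16 * varianceProxy (c₁ / 2) * Real.log p) :
    μ.real (⋃ e ∈ Finset.univ.filter (fun e : Fin p × Fin p => e.1 ≠ e.2),
      {ω | δ * (edgeVec e ⬝ᵥ pinv L *ᵥ edgeVec e)
        < |sampleDist (fun k => X k ω) e.1 e.2 - edgeVec e ⬝ᵥ pinv L *ᵥ edgeVec e|})
      ≤ 2 / (p : ℝ) ^ 2 := by
  have hp0 : (0 : ℝ) < p := by exact_mod_cast (by omega : 0 < p)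
  have hD := varianceProxy_pos (a := c₁ / 2) (by positivity)
  -- The choice of δ makes the exponent 4 log p; the factor p⁻⁴ then pays for at most p² ordered
  -- pairs.
  have hexp : Real.exp (-(n * δ ^ 2 / (4 * varianceProxy (c₁ / 2)))) = ((p : ℝ) ^ 4)⁻¹ := by
    have : 16 * varianceProxy (c₁ / 2) * Real.log p / (4 * varianceProxy (c₁ / 2))
        = Real.log ((p : ℝ) ^ 4) := by
      rw [Real.log_pow]; field_simp; push_cast; ring
    rw [hδn, this, Real.exp_neg, Real.exp_log (by positivity)]
  refine (measureReal_biUnion_finset_le _ _).trans ?_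
  calc _ ≤ ∑ e ∈ Finset.univ.filter (fun e : Fin p × Fin p => e.1 ≠ e.2),
        2 * ((p : ℝ) ^ 4)⁻¹ := by
        refine Finset.sum_le_sum fun e he => ?_
        rw [← hexp]
        exact h.measureReal_sampleDist_le hn hc₁ e
          (edgeVec_dotProduct_pinv_pos hp hL (Finset.mem_filter.1 he).2) hδ0 hδ
    _ ≤ ∑ _e : Fin p × Fin p, 2 * ((p : ℝ) ^ 4)⁻¹ :=
        Finset.sum_le_sum_of_subset_of_nonneg (Finset.filter_subset _ _) fun _ _ _ => by positivity
    _ = 2 / (p : ℝ) ^ 2 := by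
        rw [Finset.sum_const, Finset.card_univ, Fintype.card_prod, Fintype.card_fin, nsmul_eq_mul]
        push_cast
        field_simp

end

end CGL

end

/-! ### Choice of constants and conclusion -/

theorem theorem2 (c₀ c₁ : ℝ) (hc₀ : 0 < c₀) (hc₁ : 0 < c₁) :
    ∃ c' C' : ℝ, 0 < c' ∧ 0 < C' ∧
      ∀ (p n : ℕ), 2 ≤ p → c' * Real.log p ≤ n →
      ∀ Lstar ∈ CGL.laplacians (⊤ : SimpleGraph (Fin p)),
      ∀ (Ω : Type*) [MeasurableSpace Ω] (μ : Measure Ω) [IsProbabilityMeasure μ]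
        (X : Fin n → Ω → Fin p → ℝ), CGL.IsSubGaussianSample μ X Lstar c₀ c₁ →
      ∃ A : Set Ω, MeasurableSet A ∧ 1 - 2 / (p : ℝ) ^ 2 ≤ μ.real A ∧
        ∀ ω ∈ A, CGL.edgeSetOf Lstar ≤ CGL.existGraph (fun k => X k ω) ∧
          ∀ E : SimpleGraph (Fin p),
            CGL.edgeSetOf Lstar ≤ E → E ≤ CGL.existGraph (fun k => X k ω) →
            (∃ Lhat, CGL.IsCGLE E (CGL.sampleCov fun k => X k ω) Lhat) ∧
            ∀ Lhat, CGL.IsCGLE E (CGL.sampleCov fun k => X k ω) Lhat →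
              CGL.symSteinLoss Lhat Lstar ≤ C' * √(Real.log p / n) := by
  have ha : 0 < c₁ / 2 := by positivity
  set D := CGL.varianceProxy (c₁ / 2) with hDdef
  have hD : 0 < D := CGL.varianceProxy_pos ha
  -- η caps δ: 1/2 serves the loss bound and positivity of the distances, c₁/2 * D the Chernoff
  -- range. The constant 16 * D / η ^ 2 is what forces δ ≤ η.
  obtain ⟨η, hη, hη1, hη2⟩ : ∃ η : ℝ, 0 < η ∧ η ≤ 1 / 2 ∧ η ≤ c₁ / 2 * D :=
    ⟨min (1 / 2) (c₁ / 2 * D), by positivity, min_le_left _ _, min_le_right _ _⟩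
  refine ⟨16 * D / η ^ 2, 3 / 2 * √(16 * D), by positivity, by positivity, ?_⟩
  intro p n hp hpn L hL Ω _ μ _ X hX
  have hlog : 0 < Real.log p := Real.log_pos (by exact_mod_cast (by omega : 1 < p))
  have hn' : (0 : ℝ) < n := lt_of_lt_of_le (by positivity) hpn
  have hn : 0 < n := by exact_mod_cast hn'
  set δ := √(16 * D) * √(Real.log p / n) with hδ
  have hδ0 : 0 ≤ δ := by positivity
  have hδsq : δ ^ 2 = 16 * D * (Real.log p / n) := by
    rw [hδ, mul_pow, Real.sq_sqrt (by positivity), Real.sq_sqrt (by positivity)]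
  have hδη : δ ≤ η := by
    refine le_of_sq_le_sq ?_ hη.le
    rw [hδsq, ← mul_div_assoc, div_le_iff₀ hn']
    rw [div_mul_eq_mul_div, div_le_iff₀ (by positivity)] at hpn
    linarith
  set B : Set Ω := ⋃ e ∈ Finset.univ.filter (fun e : Fin p × Fin p => e.1 ≠ e.2),
      {ω | δ * (CGL.edgeVec e ⬝ᵥ CGL.pinv L *ᵥ CGL.edgeVec e)
        < |CGL.sampleDist (fun k => X k ω) e.1 e.2
          - CGL.edgeVec e ⬝ᵥ CGL.pinv L *ᵥ CGL.edgeVec e|} with hB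
  have hBle : μ.real B ≤ 2 / (p : ℝ) ^ 2 :=
    hX.measureReal_biUnion_sampleDist_le hp hn hL hc₁ hδ0 (hδη.trans hη2)
      (by rw [hδsq, ← hDdef]; field_simp)
  -- The sample is only a.e. measurable, so B is replaced by a measurable hull of the same measure.
  refine ⟨(toMeasurable μ B)ᶜ, (measurableSet_toMeasurable μ B).compl, ?_, fun ω hω => ?_⟩
  · rw [probReal_compl_eq_one_sub (measurableSet_toMeasurable μ B)]
    have : μ.real (toMeasurable μ B) = μ.real B := by
      simp [Measure.real, measure_toMeasurable]
    linarith
  · have hgood : ∀ e : Fin p × Fin p, e.1 ≠ e.2 →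
        |CGL.sampleDist (fun k => X k ω) e.1 e.2 - CGL.edgeVec e ⬝ᵥ CGL.pinv L *ᵥ CGL.edgeVec e|
          ≤ δ * (CGL.edgeVec e ⬝ᵥ CGL.pinv L *ᵥ CGL.edgeVec e) := by
      intro e he
      by_contra hlt
      refine hω (subset_toMeasurable μ B (Set.mem_biUnion (x := e) (by simpa using he) ?_))
      exact not_le.1 hlt
    -- Relative error at most 1/2 leaves at least half of a positive resistance.
    have hpos : ∀ e : Fin p × Fin p, e.1 ≠ e.2 →
        0 < CGL.sampleDist (fun k => X k ω) e.1 e.2 := by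
      intro e he
      have hr := CGL.edgeVec_dotProduct_pinv_pos hp hL he
      have := (abs_le.1 (hgood e he)).1
      nlinarith [mul_le_mul_of_nonneg_right (hδη.trans hη1) hr.le]
    refine ⟨fun i j hij => hpos (i, j) hij.ne, fun E hE _ => ?_⟩
    have hLE := CGL.mem_laplacians_of_edgeSetOf_le hL hE
    refine ⟨CGL.exists_isCGLE hp hLE fun e he => ?_, fun Lhat hLhat => ?_⟩
    · rw [CGL.edgeVec_dotProduct_sampleCov]
      exact hpos e (CGL.mem_edges.1 he).1.ne
    · rw [mul_assoc]
      refine hLhat.symSteinLoss_le hp hδ0 (hδη.trans hη1) hLE fun e he => ?_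
      rw [CGL.edgeVec_dotProduct_sampleCov]
      exact hgood e (CGL.mem_edges.1 he).1.ne
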